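/- Let $A$ be an alphabet of $m$ letters, and let $\diamond\notin A$ be the hole character. A partial word of length $n$ over $A$ is a sequence of $n$ characters from $A\cup\{\diamond\}$; its hole density is the number of its holes divided by $n$. Write $u\subset v$ if the partial words $u,v$ have equal length and $u$ is obtained from $v$ by replacing some (possibly no) letters with $\diamond$. Let $p$ be a pattern, i.e. a finite word over an alphabet of variables. Suppose that $p$ uses $r$ distinct variables, where the $j$th variable occurs $k_j\ge 1$ times, ordered so that $1=k_1=\cdots=k_s<k_{s+1}\le\cdots\le k_r$ (thus $s$ is the number of variables that occur exactly once in $p$). An occurrence of $p$ in a partial word $w$ is a pair $(i,h)$, where $i$ is a position in $w$ and $h$ assigns to every variable of $p$ a nonempty partial word over $A$, such that the factor $f$ of $w$ of length $|h(p)|$ that starts at position $i$ satisfies $f\subset h(p)$, and such that $h$ is minimal with this property: no letter of an $h(x)$ is replaced with $\diamond$ in all the instances of the variable $x$ in $f$ (such a letter is regarded as a $\diamond$ of $h(x)$). Assume that $m\ge 2$, or that $m=1$ and no variable is repeated in $p$ (so that $s=r$). Let $d\in\mathbb Q\cap(0,1)$. For $n\ge 1$ with $dn\in\mathbb Z$ let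 $\widehat\Omega_{n,d}$ be the mean number of occurrences of $p$ in a partial word chosen uniformly among all partial words of length $n$ over $A$ with hole density $d$. Then, as $n\to\infty$ through the integers with $dn\in\mathbb Z$, $$\widehat{\Omega}_{n,d}\sim\frac{n^{s+1}}{(s+1)!}\prod_{j=s+1}^r\frac{Q_j}{m^{k_j-1}-Q_j},\qquad Q_j=[1+d(m-1)]^{k_j}-\left(1-\frac1m\right)(md)^{k_j}.$$ -/

import Mathlib

open Filter Asymptotics
open scoped Nat

/-! A partial word over the alphabet `A` is a sequence with entries in `Option A`; the entry `none`
is the hole `◇`, and `some a` is the letter `a`. -/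

namespace PartialWord

/-- `Contained u v`: the partial words `u` and `v` have the same length and `u` is obtained from `v`
by replacing some (possibly no) letters with holes. If `v` is a full word, this says exactly that
`u` and `v` are compatible, i.e. agree wherever `u` has a letter. -/
def Contained {A : Type*} (u v : List (Option A)) : Prop :=
  List.Forall₂ (fun a b => a = none ∨ a = b) u v

/-- A substitution for the pattern `p` assigns a partial word to every variable of `p`. -/
abbrev Subst {V : Type*} (p : List V) (A : Type*) : Type _ :=
  {v : V // v ∈ p} → List (Option A)

/-- The image `h(p)` of the pattern `p`: the concatenation of the images of its variables. -/
def Subst.image {V A : Type*} {p : List V} (h : Subst p A) : List (Option A) :=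
  p.attach.flatMap h

/-- `Matches h f`: `h` is nonerasing, `f` is obtained from `h(p)` by replacing some letters with
holes, and `h` is minimal (under containment) with this property, that is, a letter of some `h(v)`
may not be replaced with a hole in every instance of `v` (such a letter is treated as a hole
of `h(v)`). In particular, if `f` is a full word then `h(v)` is full for all `v` and `h(p) = f`. -/
def Matches {V A : Type*} {p : List V} (h : Subst p A) (f : List (Option A)) : Prop :=
  (∀ v, h v ≠ []) ∧ Contained f h.image ∧
    ∀ g : Subst p A, (∀ v, Contained (g v) (h v)) → Contained f g.image → g = h

/-- The occurrences of `p` in the partial word `w`: pairs of a starting position `i` and a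
substitution `h` that matches a factor `f` of `w` starting at position `i`. -/
def occurrences {V A : Type*} (p : List V) (w : List (Option A)) : Set (ℕ × Subst p A) :=
  {q | ∃ x f y, w = x ++ f ++ y ∧ x.length = q.1 ∧ Matches q.2 f}

/-- The cardinality of the set of occurrences is a genuine one: the set is finite. -/
theorem occurrences_finite {V A : Type*} [Finite A] (p : List V) (w : List (Option A)) :
    (occurrences p w).Finite := by
  have : Finite {v : V // v ∈ p} := List.finite_toSet p |>.to_subtype
  have h1 : (Set.univ.pi (fun _ : {v : V // v ∈ p} => {l : List (Option A) | l.length ≤ w.length})).Finite :=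
    Set.Finite.pi' (fun _ => List.finite_length_le (Option A) w.length) |>.subset (fun f hf v => hf v trivial)
  refine ((Set.finite_Iic w.length).prod h1).subset ?_
  rintro ⟨i, h⟩ ⟨x, f, y, hw, hx, -, hc, -⟩
  have hl := hc.length_eq
  subst hw
  refine ⟨by simp at hx ⊢; omega, fun v _ => ?_⟩
  have hs : (h v).Sublist (Subst.image h) := by
    have := List.sublist_flatten_of_mem (List.mem_map_of_mem (f := h) (List.mem_attach p v))
    simpa [Subst.image, List.flatMap] using this
  have hs2 := hs.length_le
  show (h v).length ≤ (x ++ f ++ y).length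
  simp only [List.length_append]
  simp only at hl
  omega

/-- The number of holes. -/
def holes {A : Type*} {n : ℕ} (w : Fin n → Option A) : ℕ :=
  (Finset.univ.filter fun i => (w i).isNone).card

/-- The partial words of length `n` over `A` with hole density `d`. -/
def withDensity (A : Type*) [Fintype A] (n : ℕ) (d : ℚ) : Finset (Fin n → Option A) :=
  Finset.univ.filter fun w => (holes w : ℚ) / n = d

/-- The mean number of occurrences of `p` in a partial word of length `n` over `A` with hole
density `d`, all such words being equally likely. -/
noncomputable def meanOccurrences {V : Type*} (p : List V) (A : Type*) [Fintype A]
    (n : ℕ) (d : ℚ) : ℝ :=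
  (∑ w ∈ withDensity A n d, ((occurrences p (List.ofFn w)).ncard : ℝ)) /
    (withDensity A n d).card

/-- `Q = [1 + d(m-1)]^k - (1 - 1/m)(md)^k`. -/
noncomputable def Q (m : ℕ) (d : ℝ) (k : ℕ) : ℝ :=
  (1 + d * ((m : ℝ) - 1)) ^ k - (1 - 1 / (m : ℝ)) * ((m : ℝ) * d) ^ k

end PartialWord

/-! Once the starting position and the block lengths are fixed, an occurrence exists exactly when
the blocks of each variable are pairwise compatible, and minimality forces `h` to be the join of
these blocks. So occurrences are counted by pairs (position, lengths) satisfying `Fits`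
(`matches_iff`, `ncard_occurrences`).

By linearity the mean is a sum of probabilities over such pairs. A uniform word with a fixed number
of holes is exchangeable, so each probability depends only on the lengths `l` of the repeated
variables: it is the chance `columnsProb` that the columns of an array filled from distinct
positions are compatible. The starting position and the lengths of the `s` unrepeated variables are
free; if the repeated variables occupy `L` cells, stars and bars gives `(n + 1 - L).choose (s + 1)`
choices (`card_arrangements_fiber`). This yields an exact formula for the mean
(`meanOccurrences_eq`).

Divide by `n ^ (s + 1)` and let `n` grow. For fixed `l`, sampling without replacement becomes
independent sampling, and the summand tends to `∏ q_v ^ l_v / (s + 1)!`, where `q_v = Q / m ^ (k -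
1)` is the probability that one column of height `k` is compatible. As `q_v < 1` (`Q_lt`), summing
over lengths at least 1 gives `q_v / (1 - q_v) = Q / (m ^ (k - 1) - Q)`.

Exchanging limit and sum needs a majorant uniform in `n`, although `L` may be as large as `n`.
Keeping only a fraction `1 / N` of the columns increases the probability and uses at most `n / N`
cells; there, the absence of replacement costs at most a factor `N / (N - 1)` per cell. For large
`N` the corrected ratios stay below 1, and the majorant is summable (`columnsProb_le_prod`). -/

namespace PartialWord

/-! ### Occurrences as compatible cuttings of a factor -/

/-- Two characters are compatible if they agree unless one of them is a hole. -/
def Compat {A : Type*} (a b : Option A) : Prop :=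
  a = none ∨ b = none ∨ a = b

theorem Compat.refl {A : Type*} (a : Option A) : Compat a a := Or.inr (Or.inr rfl)

/-- The offset of the `t`-th block in a concatenation of blocks of lengths `l (q₀), l (q₁), …`. -/
def start {W : Type*} (q : List W) (l : W → ℕ) (t : ℕ) : ℕ :=
  ((q.take t).map l).sum

theorem start_add_lt {W : Type*} (q : List W) (l : W → ℕ) (t : ℕ) (ht : t < q.length) {c : ℕ}
    (hc : c < l q[t]) : start q l t + c < (q.map l).sum := by
  induction q generalizing t with
  | nil => simp at ht
  | cons a q ih =>
    cases t with
    | zero => simp [start] at hc ⊢; omega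
    | succ t =>
      have := ih t (by simpa using ht) (by simpa using hc)
      simp [start] at this ⊢; omega

theorem start_add_inj {W : Type*} (q : List W) (l : W → ℕ) (t t' : ℕ) (ht : t < q.length)
    (ht' : t' < q.length) {c c' : ℕ} (hc : c < l q[t]) (hc' : c' < l q[t'])
    (h : start q l t + c = start q l t' + c') : t = t' ∧ c = c' := by
  induction q generalizing t t' with
  | nil => simp at ht
  | cons a q ih =>
    cases t with
    | zero =>
      cases t' with
      | zero => simpa [start] using h
      | succ t' => simp [start] at h hc; omega
    | succ t =>
      cases t' with
      | zero => simp [start] at h hc'; omega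
      | succ t' =>
        have := ih t t' (by simpa using ht) (by simpa using ht') (by simpa using hc)
          (by simpa using hc') (by simp [start] at h ⊢; omega)
        simpa using this

/-- The default `none` in `getD` is never read: the length equation keeps every index in range. -/
theorem contained_flatMap_iff {W A : Type*} (q : List W) (h : W → List (Option A))
    (f : List (Option A)) :
    Contained f (q.flatMap h) ↔ f.length = (q.map fun v => (h v).length).sum ∧
      ∀ (t : ℕ) (ht : t < q.length) (c : ℕ) (hc : c < (h q[t]).length),
        f.getD (start q (fun v => (h v).length) t + c) none = none ∨
          f.getD (start q (fun v => (h v).length) t + c) none = (h q[t])[c] := by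
  induction q generalizing f with
  | nil => simp [Contained]
  | cons a q ih =>
    have key : Contained f ((a :: q).flatMap h) ↔
        (h a).length ≤ f.length ∧ Contained (f.take (h a).length) (h a) ∧
          Contained (f.drop (h a).length) (q.flatMap h) := by
      rw [List.flatMap_cons]
      constructor
      · intro H
        have h1 := List.forall₂_take_append _ _ _ H
        have h2 := List.forall₂_drop_append _ _ _ H
        have := List.Forall₂.length_eq H
        refine ⟨by simp at this; omega, h1, h2⟩
      · rintro ⟨-, h1, h2⟩
        have : Contained (f.take (h a).length ++ f.drop (h a).length) (h a ++ q.flatMap h) :=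
          List.rel_append h1 h2
        rwa [List.take_append_drop] at this
    rw [key, ih]
    have h3 : (h a).length ≤ f.length → (Contained (f.take (h a).length) (h a) ↔
        ∀ (c : ℕ) (hc : c < (h a).length), f.getD c none = none ∨ f.getD c none = (h a)[c]) := by
      intro hle
      rw [Contained, List.forall₂_iff_get]
      constructor
      · rintro ⟨-, H⟩ c hc
        rw [List.getD_eq_getElem f none (show c < f.length by omega)]
        simpa using H c (by simp; omega) hc
      · intro H
        refine ⟨by simp [hle], fun c h1 h2 => ?_⟩
        have := H c h2
        rw [List.getD_eq_getElem f none (show c < f.length by omega)] at this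
        simpa using this
    constructor
    · rintro ⟨hle, h1, hl, h2⟩
      refine ⟨by simp at hl ⊢; omega, fun t ht c hc => ?_⟩
      cases t with
      | zero => simpa [start] using (h3 hle).1 h1 c (by simpa using hc)
      | succ t =>
        have := h2 t (by simpa using ht) c (by simpa using hc)
        simpa [start, List.getD, List.getElem?_drop, add_assoc] using this
    · rintro ⟨hl, H⟩
      have hle : (h a).length ≤ f.length := by simp at hl; omega
      refine ⟨hle, (h3 hle).2 fun c hc => ?_, by simp at hl ⊢; omega, fun t ht c hc => ?_⟩
      · have := H 0 (by simp) c (by simpa using hc)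
        simp only [start, List.take_zero, List.map_nil, List.sum_nil, zero_add] at this
        exact this
      · have := H (t + 1) (by simpa using ht) c (by simpa using hc)
        simpa [start, List.getD, List.getElem?_drop, add_assoc] using this

/-- `Fits q x l`: if the word `x` is cut into blocks of lengths `l (q₀), l (q₁), …`, then
the blocks that belong to the same variable are pairwise compatible. -/
def Fits {W A : Type*} (q : List W) (x : ℕ → Option A) (l : W → ℕ) : Prop :=
  ∀ t t' : Fin q.length, q.get t = q.get t' → ∀ c < l (q.get t),
    Compat (x (start q l t + c)) (x (start q l t' + c))

open Classical in
/-- The join of the characters at offset `c` in the blocks of the variable `v`. -/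
noncomputable def join {W A : Type*} (q : List W) (x : ℕ → Option A) (l : W → ℕ) (v : W) (c : ℕ) :
    Option A :=
  if h : ∃ t : Fin q.length, q.get t = v ∧ x (start q l t + c) ≠ none then
    x (start q l h.choose + c) else none

theorem join_eq_none_iff {W A : Type*} {q : List W} {x : ℕ → Option A} {l : W → ℕ} {v : W}
    {c : ℕ} : join q x l v c = none ↔
      ∀ t : Fin q.length, q.get t = v → x (start q l t + c) = none := by
  unfold join
  split_ifs with h
  · constructor
    · exact fun h' => absurd h' h.choose_spec.2
    · intro H
      obtain ⟨t, h1, h2⟩ := h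
      exact absurd (H t h1) h2
  · push Not at h
    simpa using h

theorem exists_of_join_ne_none {W A : Type*} {q : List W} {x : ℕ → Option A} {l : W → ℕ} {v : W}
    {c : ℕ} (h : join q x l v c ≠ none) :
    ∃ t : Fin q.length, q.get t = v ∧ x (start q l t + c) ≠ none ∧
      join q x l v c = x (start q l t + c) := by
  unfold join at h ⊢
  split_ifs at h ⊢ with h'
  · exact ⟨h'.choose, h'.choose_spec.1, h'.choose_spec.2, rfl⟩
  · exact absurd rfl h

/-- `join` chooses an arbitrary instance carrying a letter; compatibility makes that choice
immaterial. -/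
theorem Fits.eq_none_or_eq_join {W A : Type*} {q : List W} {x : ℕ → Option A} {l : W → ℕ}
    (H : Fits q x l) (t : Fin q.length) {c : ℕ} (hc : c < l (q.get t)) :
    x (start q l t + c) = none ∨ x (start q l t + c) = join q x l (q.get t) c := by
  by_cases h : join q x l (q.get t) c = none
  · exact Or.inl (join_eq_none_iff.1 h t rfl)
  · obtain ⟨t', h1, h2, h3⟩ := exists_of_join_ne_none h
    rcases H t t' h1.symm c hc with h | h | h
    · exact Or.inl h
    · exact absurd h h2
    · exact Or.inr (h.trans h3.symm)

/-- If `h` matches, the join is contained in `h` and still contains the factor, so minimality makes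
them equal. Conversely, every letter of the join is visible in some instance, so no smaller
substitution can drop it. -/
theorem matches_iff {V A : Type*} {p : List V} (h : Subst p A) (f : List (Option A)) :
    Matches h f ↔ (∀ v, h v ≠ []) ∧ f.length = (p.attach.map fun v => (h v).length).sum ∧
      Fits p.attach (fun j => f.getD j none) (fun v => (h v).length) ∧
      ∀ v, h v = List.ofFn fun c : Fin (h v).length =>
        join p.attach (fun j => f.getD j none) (fun v => (h v).length) v c := by
  unfold Matches Subst.image
  rw [contained_flatMap_iff]
  refine and_congr_right fun _ => ?_
  rw [and_assoc]
  refine and_congr_right fun hlen => ?_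
  set l : {v // v ∈ p} → ℕ := fun v => (h v).length with hl
  have hlen_of : ∀ g : Subst p A, (∀ v, Contained (g v) (h v)) → (fun v => (g v).length) = l :=
    fun g hg => funext fun v => (hg v).length_eq
  constructor
  · rintro ⟨hc, hmin⟩
    have hfit : Fits p.attach (fun j => f.getD j none) l := by
      intro t t' htt c hcl
      have h1 := hc t t.2 c hcl
      have h2 := hc t' t'.2 c (by simp only [List.get_eq_getElem] at htt hcl; rwa [← htt])
      have h4 : ∀ u : {v // v ∈ p}, u = p.attach[(t : ℕ)] → ∀ hu : c < (h u).length,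
          (h u)[c] = (h p.attach[(t : ℕ)])[c] := by
        rintro u rfl _; rfl
      rw [h4 p.attach[(t' : ℕ)] htt.symm] at h2
      rcases h1 with h1 | h1
      · exact Or.inl h1
      · rcases h2 with h2 | h2
        · exact Or.inr (Or.inl h2)
        · exact Or.inr (Or.inr (h1.trans h2.symm))
    refine ⟨hfit, ?_⟩
    let g : Subst p A := fun v => List.ofFn fun c : Fin (h v).length =>
        join p.attach (fun j => f.getD j none) l v c
    have hg : g = h := by
      have hgl : (fun v => (g v).length) = l := by funext v; simp [g, hl]
      refine hmin g (fun v => ?_) ?_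
      · rw [Contained, List.forall₂_iff_get]
        refine ⟨by simp [g], fun c h1 h2 => ?_⟩
        simp only [g, List.get_eq_getElem, List.getElem_ofFn]
        by_cases hj : join p.attach (fun j => f.getD j none) l v c = none
        · exact Or.inl hj
        · obtain ⟨t, rfl, h4, h5⟩ := exists_of_join_ne_none hj
          rw [h5]
          exact hc t t.2 c h2
      · rw [contained_flatMap_iff, hgl]
        refine ⟨hlen, fun t ht c hcl => ?_⟩
        have := hfit.eq_none_or_eq_join ⟨t, ht⟩ (c := c) (by simpa [g] using hcl)
        simpa [g] using this
    intro v
    exact (congrFun hg v).symm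
  · rintro ⟨hfit, hj⟩
    have hget : ∀ v c (hcv : c < (h v).length), (h v)[c] =
        join p.attach (fun j => f.getD j none) l v c := by
      intro v c hcv
      have : (h v)[c]? = (List.ofFn fun c : Fin (h v).length =>
        join p.attach (fun j => f.getD j none) l v c)[c]? := congrArg (fun z => z[c]?) (hj v)
      simpa [hcv] using this
    refine ⟨fun t ht c hcl => ?_, fun g hg hgf => ?_⟩
    · rw [hget]
      exact hfit.eq_none_or_eq_join ⟨t, ht⟩ hcl
    · have hgl := hlen_of g hg
      have hgl' : ∀ v, (g v).length = (h v).length := fun v => congrFun hgl v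
      rw [contained_flatMap_iff, hgl] at hgf
      funext v
      refine List.ext_getElem (hgl' v) fun c h1 h2 => ?_
      have h3 := (List.forall₂_iff_get.1 (hg v)).2 c h1 h2
      simp only [List.get_eq_getElem] at h3
      rcases h3 with h3 | h3
      · by_cases hn : join p.attach (fun j => f.getD j none) l v c = none
        · rw [h3, hget, hn]
        · obtain ⟨t, rfl, h4, h5⟩ := exists_of_join_ne_none hn
          rcases hgf.2 t t.2 c h1 with h6 | h6
          · exact absurd h6 h4
          · rw [hget _ _ h2, h5]; exact h6.symm
      · exact h3

/-- The bijection sends `(i, h)` to `(i, lengths of h)`. It is injective because position and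
lengths determine the factor, whose joins determine `h`. -/
theorem ncard_occurrences {V A : Type*} (p : List V) (w : List (Option A)) :
    (occurrences p w).ncard =
      {z : ℕ × ({v // v ∈ p} → ℕ) | (∀ v, 1 ≤ z.2 v) ∧
        z.1 + (p.attach.map z.2).sum ≤ w.length ∧
        Fits p.attach (fun j => w.getD (z.1 + j) none) z.2}.ncard := by
  -- `Fits` reads only the first `∑ l` characters, so the factor and the whole shifted word can be
  -- interchanged.
  have fits_congr : ∀ (x y : ℕ → Option A) (l : {v // v ∈ p} → ℕ),
      (∀ j < (p.attach.map l).sum, x j = y j) → Fits p.attach x l → Fits p.attach y l := by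
    intro x y l hxy H t t' htt c hc
    rw [← hxy _ (start_add_lt _ _ _ t.2 hc), ← hxy _ (start_add_lt _ _ _ t'.2 (show c < l (p.attach.get t') from htt ▸ hc))]
    exact H t t' htt c hc
  have hfac : ∀ (x f y : List (Option A)), ∀ j < f.length,
      f.getD j none = (x ++ f ++ y).getD (x.length + j) none := by
    intro x f y j hj
    simp [List.getD, List.getElem?_append, hj]
  refine Set.ncard_congr (fun q _ => (q.1, fun v => (q.2 v).length)) ?_ ?_ ?_
  · rintro ⟨i, h⟩ ⟨x, f, y, rfl, rfl, hm⟩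
    obtain ⟨h1, h2, h3, h4⟩ := (matches_iff _ _).1 hm
    refine ⟨fun v => List.length_pos_iff.2 (h1 v), ?_, ?_⟩
    · simp only [List.length_append] at h2 ⊢; omega
    · exact fits_congr _ _ _ (fun j hj => hfac x f y j (h2 ▸ hj)) h3
  · rintro ⟨i, h⟩ ⟨i', h'⟩ ⟨x, f, y, hw, hi, hm⟩ ⟨x', f', y', hw', hi', hm'⟩ heq
    simp only [Prod.mk.injEq] at heq hi hi' hm hm'
    obtain ⟨rfl, hl⟩ := heq
    obtain ⟨-, h2, -, h4⟩ := (matches_iff _ _).1 hm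
    obtain ⟨-, h2', -, h4'⟩ := (matches_iff _ _).1 hm'
    have hff : f = f' := by
      have hlen : f.length = f'.length := by rw [h2, h2', hl]
      have := (List.append_inj (hw.symm.trans hw') (by simp; omega)).1
      exact (List.append_inj this (by omega)).2
    subst hff
    rw [← hl] at h4'
    have : h = h' := by
      funext v
      rw [h4 v, h4' v]
      have hv : (h v).length = (h' v).length := congrFun hl v
      rw [hv]
    rw [this]
  · rintro ⟨i, l⟩ ⟨h1, h2, h3⟩
    simp only at h1 h2 h3
    set L := (p.attach.map l).sum
    set f := (w.drop i).take L with hf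
    have hfl : f.length = L := by simp [hf]; omega
    have hw : w = w.take i ++ f ++ (w.drop i).drop L := by
      rw [List.append_assoc, List.take_append_drop, List.take_append_drop]
    have hxl : (w.take i).length = i := by simp; omega
    have hfg : ∀ j < L, f.getD j none = w.getD (i + j) none := by
      intro j hj
      have := hfac (w.take i) f ((w.drop i).drop L) j (by omega)
      rwa [← hw, hxl] at this
    have h3' : Fits p.attach (fun j => f.getD j none) l :=
      fits_congr _ _ _ (fun j hj => (hfg j hj).symm) h3
    let h : Subst p A := fun v => List.ofFn fun c : Fin (l v) =>
      join p.attach (fun j => f.getD j none) l v c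
    have hhl : (fun v => (h v).length) = l := by funext v; simp [h]
    refine ⟨(i, h), ⟨w.take i, f, (w.drop i).drop L, hw, hxl, ?_⟩, by simp [hhl]⟩
    rw [matches_iff]
    change (∀ v, h v ≠ []) ∧ f.length = (p.attach.map fun v => (h v).length).sum ∧
      Fits p.attach (fun j => f.getD j none) (fun v => (h v).length) ∧
      ∀ v, h v = List.ofFn fun c : Fin (h v).length =>
        join p.attach (fun j => f.getD j none) (fun v => (h v).length) v c
    rw [hhl]
    refine ⟨fun v hv => ?_, hfl, h3', fun v => ?_⟩
    · have : (h v).length = 0 := by rw [hv]; rfl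
      have h5 := congrFun hhl v
      have h6 := h1 v
      omega
    · exact List.ofFn_congr (by simp [h]) _

/-! ### Random words with a fixed number of holes -/

/-- The number of holes of a family of characters. -/
def numHoles {S A : Type*} [Fintype S] (u : S → Option A) : ℕ :=
  (Finset.univ.filter fun i => (u i).isNone).card

theorem numHoles_le {S A : Type*} [Fintype S] (u : S → Option A) :
    numHoles u ≤ Fintype.card S :=
  Finset.card_le_univ _

theorem numHoles_eq_sum {S A : Type*} [Fintype S] (u : S → Option A) :
    numHoles u = ∑ i, if (u i).isNone then 1 else 0 := by
  rw [numHoles, Finset.card_filter]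

theorem numHoles_comp_equiv {S T A : Type*} [Fintype S] [Fintype T] (e : S ≃ T)
    (u : T → Option A) : numHoles (u ∘ e) = numHoles u := by
  rw [numHoles_eq_sum, numHoles_eq_sum]
  exact e.sum_comp fun i => if (u i).isNone then 1 else 0

theorem numHoles_sum {S T A : Type*} [Fintype S] [Fintype T] (u : S ⊕ T → Option A) :
    numHoles u = numHoles (u ∘ Sum.inl) + numHoles (u ∘ Sum.inr) := by
  simp only [numHoles_eq_sum, Fintype.sum_sum_type, Function.comp]

theorem card_numHoles_eq {T A : Type*} [Fintype T] [Fintype A] [DecidableEq T] (K : ℕ) :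
    (Finset.univ.filter fun w : T → Option A => numHoles w = K).card =
      (Fintype.card T).choose K * Fintype.card A ^ (Fintype.card T - K) := by
  classical
  rw [Finset.card_eq_sum_card_fiberwise
    (f := fun w : T → Option A => Finset.univ.filter fun i => (w i).isNone)
    (t := Finset.powersetCard K Finset.univ)
    (fun w hw => by simpa [Finset.mem_powersetCard, numHoles] using hw)]
  rw [Finset.sum_const_nat (m := Fintype.card A ^ (Fintype.card T - K)), Finset.card_powersetCard,
    Finset.card_univ]
  intro Z hZ
  have hZ' : Z.card = K := (Finset.mem_powersetCard.1 hZ).2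
  have : ((Finset.univ.filter fun w : T → Option A => numHoles w = K).filter
      fun w => (Finset.univ.filter fun i => (w i).isNone) = Z) =
      Fintype.piFinset fun i => if i ∈ Z then {none} else Finset.univ.erase (none : Option A) := by
    ext w
    simp only [Finset.mem_filter, Finset.mem_univ, true_and, Fintype.mem_piFinset]
    constructor
    · rintro ⟨-, h⟩ i
      have := Finset.ext_iff.1 h i
      simp only [Finset.mem_filter, Finset.mem_univ, true_and, Option.isNone_iff_eq_none] at this
      split_ifs with hi
      · simpa using this.2 hi
      · simpa using fun h' => hi (this.1 h')
    · intro h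
      have h' : (Finset.univ.filter fun i => (w i).isNone) = Z := by
        ext i
        have := h i
        simp only [Finset.mem_filter, Finset.mem_univ, true_and, Option.isNone_iff_eq_none]
        split_ifs at this with hi
        · simpa [hi] using this
        · simpa [hi] using this
      exact ⟨by rw [numHoles, h', hZ'], h'⟩
  rw [this, Fintype.card_piFinset]
  have h2 : ∀ i, (if i ∈ Z then {none} else Finset.univ.erase (none : Option A)).card =
      if i ∈ Z then 1 else Fintype.card A := by
    intro i
    split_ifs
    · simp
    · rw [Finset.card_erase_of_mem (Finset.mem_univ _), Finset.card_univ, Fintype.card_option]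
      simp
  simp only [h2]
  rw [Finset.prod_ite]
  simp only [Finset.prod_const_one, one_mul, Finset.prod_const]
  congr 1
  rw [← hZ', ← Finset.card_compl]
  congr 1
  ext i
  simp

/-- The probability that `h` given positions carry holes and `g` other given positions carry given
letters, in a random word of length `n` with `K` holes over an alphabet of `m` letters. -/
noncomputable def patternProb (m n K h g : ℕ) : ℝ :=
  K.descFactorial h * (n - K).descFactorial g / (n.descFactorial (h + g) * (m : ℝ) ^ g)

theorem patternProb_nonneg (m n K h g : ℕ) : 0 ≤ patternProb m n K h g := by
  unfold patternProb; positivity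

/-- Multiplied by `a ! * b !`, both sides become `(a + h + (b + g))!`. -/
theorem choose_mul_descFactorial (a b h g : ℕ) :
    (a + b).choose a * (a + h + (b + g)).descFactorial (h + g) =
      (a + h + (b + g)).choose (a + h) * ((a + h).descFactorial h * (b + g).descFactorial g) := by
  have e1 : a ! * (a + h).descFactorial h = (a + h)! := by
    simpa using Nat.factorial_mul_descFactorial (show h ≤ a + h by omega)
  have e2 : b ! * (b + g).descFactorial g = (b + g)! := by
    simpa using Nat.factorial_mul_descFactorial (show g ≤ b + g by omega)
  have e3 : (a + b)! * (a + h + (b + g)).descFactorial (h + g) = (a + h + (b + g))! := by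
    have := Nat.factorial_mul_descFactorial (show h + g ≤ a + h + (b + g) by omega)
    rwa [show a + h + (b + g) - (h + g) = a + b by omega] at this
  have e4 : (a + b).choose a * a ! * b ! = (a + b)! := by
    rw [Nat.choose_symm_add, Nat.add_choose_mul_factorial_mul_factorial]
  have e5 : (a + h + (b + g)).choose (a + h) * (a + h)! * (b + g)! = (a + h + (b + g))! := by
    rw [Nat.choose_symm_add, Nat.add_choose_mul_factorial_mul_factorial]
  have hpos : 0 < a ! * b ! := by positivity
  apply Nat.eq_of_mul_eq_mul_right hpos
  calc _ = ((a + b).choose a * a ! * b !) * (a + h + (b + g)).descFactorial (h + g) := by ring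
    _ = (a + h + (b + g))! := by rw [e4, e3]
    _ = (a + h + (b + g)).choose (a + h) * (a + h)! * (b + g)! := e5.symm
    _ = (a + h + (b + g)).choose (a + h) * (a ! * (a + h).descFactorial h) *
        (b ! * (b + g).descFactorial g) := by rw [e1, e2]
    _ = _ := by ring

/-- The words extending `u` correspond to fillings of `T` with the remaining holes. If too few holes
or letters are available, both sides vanish. -/
theorem card_comp_inl_eq {S T A : Type*} [Fintype S] [Fintype T] [Fintype A] [DecidableEq S]
    [DecidableEq T] [DecidableEq A] (hA : 0 < Fintype.card A) (K : ℕ)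
    (hK : K ≤ Fintype.card S + Fintype.card T) (u : S → Option A) :
    ((Finset.univ.filter fun w : S ⊕ T → Option A => numHoles w = K ∧ w ∘ Sum.inl = u).card : ℝ) =
      (Finset.univ.filter fun w : S ⊕ T → Option A => numHoles w = K).card *
        patternProb (Fintype.card A) (Fintype.card S + Fintype.card T) K (numHoles u)
          (Fintype.card S - numHoles u) := by
  have hu := numHoles_le u
  have h1 : (Finset.univ.filter fun w : S ⊕ T → Option A =>
      numHoles w = K ∧ w ∘ Sum.inl = u).card =
      (Finset.univ.filter fun w : T → Option A => numHoles u + numHoles w = K).card := by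
    refine Finset.card_bij' (fun w _ => w ∘ Sum.inr) (fun w _ => Sum.elim u w) ?_ ?_ ?_ ?_
    · intro w hw
      simp only [Finset.mem_filter, Finset.mem_univ, true_and] at hw ⊢
      rw [← hw.2, ← numHoles_sum, hw.1]
    · intro w hw
      simp only [Finset.mem_filter, Finset.mem_univ, true_and] at hw ⊢
      rw [numHoles_sum]
      simpa using hw
    · intro w hw
      simp only [Finset.mem_filter, Finset.mem_univ, true_and] at hw ⊢
      rw [← hw.2]
      exact Sum.elim_comp_inl_inr w
    · intro w hw
      rfl
  rw [h1, card_numHoles_eq, Fintype.card_sum]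
  set N := Fintype.card S + Fintype.card T with hN
  set h := numHoles u
  obtain ⟨g, hg⟩ : ∃ g, Fintype.card S = h + g := ⟨_, (Nat.add_sub_cancel' hu).symm⟩
  have hgg : Fintype.card S - h = g := by omega
  rw [hgg, patternProb]
  by_cases hhK : h ≤ K
  · obtain ⟨a, rfl⟩ : ∃ a, K = a + h := ⟨K - h, by omega⟩
    have h2 : (Finset.univ.filter fun w : T → Option A => h + numHoles w = a + h) =
        Finset.univ.filter fun w : T → Option A => numHoles w = a := by
      ext w; simp; omega
    rw [h2, card_numHoles_eq]
    by_cases hgK : g ≤ N - (a + h)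
    · obtain ⟨b, hb⟩ : ∃ b, N - (a + h) = b + g := ⟨N - (a + h) - g, by omega⟩
      have hN' : N = a + h + (b + g) := by omega
      have hT : Fintype.card T = a + b := by omega
      have e := choose_mul_descFactorial a b h g
      rw [← hN'] at e
      rw [hT, hb, show a + b - a = b by omega]
      have hpos : (0 : ℝ) < N.descFactorial (h + g) := by
        exact_mod_cast Nat.descFactorial_pos.2 (by omega)
      have hm : (0 : ℝ) < Fintype.card A := by exact_mod_cast hA
      have e' : ((a + b).choose a : ℝ) * N.descFactorial (h + g) =
          N.choose (a + h) * ((a + h).descFactorial h * (b + g).descFactorial g) := by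
        exact_mod_cast e
      push_cast
      rw [mul_div_assoc', eq_div_iff (by positivity)]
      calc _ = ((a + b).choose a : ℝ) * N.descFactorial (h + g) *
            ((Fintype.card A : ℝ) ^ b * (Fintype.card A : ℝ) ^ g) := by ring
        _ = _ := by rw [e', ← pow_add]; ring
    · rw [Nat.descFactorial_eq_zero_iff_lt.2 (by omega : N - (a + h) < g),
        Nat.choose_eq_zero_of_lt (by omega)]
      simp
  · rw [Nat.descFactorial_eq_zero_iff_lt.2 (by omega : K < h)]
    have : (Finset.univ.filter fun w : T → Option A => h + numHoles w = K) = ∅ := by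
      ext w; simp; omega
    simp [this]

/-- Exchangeability: only the injectivity of `f` matters, since `T` splits as the range of `f` and
its complement. -/
theorem card_comp_eq {S T A : Type*} [Fintype S] [Fintype T] [Fintype A] [DecidableEq S]
    [DecidableEq T] [DecidableEq A] (hA : 0 < Fintype.card A) (K : ℕ)
    (hK : K ≤ Fintype.card T) (f : S → T) (hf : f.Injective) (u : S → Option A) :
    ((Finset.univ.filter fun w : T → Option A => numHoles w = K ∧ w ∘ f = u).card : ℝ) =
      (Finset.univ.filter fun w : T → Option A => numHoles w = K).card *
        patternProb (Fintype.card A) (Fintype.card T) K (numHoles u)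
          (Fintype.card S - numHoles u) := by
  classical
  let e : S ⊕ {x // x ∉ Set.range f} ≃ T :=
    ((Equiv.ofInjective f hf).sumCongr (Equiv.refl _)).trans (Equiv.Set.sumCompl (Set.range f))
  have he : e ∘ Sum.inl = f := by
    funext s; rfl
  have hcard : Fintype.card T = Fintype.card S + Fintype.card {x // x ∉ Set.range f} := by
    rw [← Fintype.card_sum]; exact (Fintype.card_congr e).symm
  have h1 : ∀ P : (S ⊕ {x // x ∉ Set.range f} → Option A) → Prop, ∀ [DecidablePred P],
      (Finset.univ.filter fun w : T → Option A => P (w ∘ e)).card =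
      (Finset.univ.filter P).card := by
    intro P _
    refine Finset.card_equiv (e.symm.arrowCongr (Equiv.refl _)) fun w => ?_
    simp only [Finset.mem_filter, Finset.mem_univ, true_and]
    rfl
  have h2 := h1 fun w => numHoles w = K ∧ w ∘ Sum.inl = u
  have h3 := h1 fun w => numHoles w = K
  simp only [numHoles_comp_equiv, Function.comp_assoc, he] at h2 h3
  rw [h2, h3, hcard]
  exact card_comp_inl_eq hA K (hcard ▸ hK) u

open Classical in
theorem card_comp_mem {S T A : Type*} [Fintype S] [Fintype T] [Fintype A]
    (hA : 0 < Fintype.card A) (K : ℕ)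
    (hK : K ≤ Fintype.card T) (f : S → T) (hf : f.Injective) (E : (S → Option A) → Prop) :
    ((Finset.univ.filter fun w : T → Option A => numHoles w = K ∧ E (w ∘ f)).card : ℝ) =
      (Finset.univ.filter fun w : T → Option A => numHoles w = K).card *
        ∑ u : S → Option A with E u, patternProb (Fintype.card A) (Fintype.card T) K (numHoles u)
          (Fintype.card S - numHoles u) := by
  rw [Finset.card_eq_sum_card_fiberwise (f := fun w : T → Option A => w ∘ f)
    (t := Finset.univ.filter E) (fun w hw => by simp at hw ⊢; exact hw.2)]
  push_cast
  rw [Finset.mul_sum]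
  refine Finset.sum_congr rfl fun u hu => ?_
  rw [← card_comp_eq hA K hK f hf u, Finset.filter_filter]
  congr 2
  ext w
  simp only [Finset.mem_filter, Finset.mem_univ, true_and] at hu ⊢
  constructor
  · rintro ⟨⟨h1, -⟩, h2⟩; exact ⟨h1, h2⟩
  · rintro ⟨h1, h2⟩; exact ⟨⟨h1, h2 ▸ hu⟩, h2⟩

/-! ### Probability that all columns are compatible -/

/-- The cells of an array that has, for every `v`, `l v` columns indexed by `T v`. -/
abbrev Cells {R : Type*} (T : R → Type*) (l : R → ℕ) : Type _ :=
  Σ c : (Σ v, Fin (l v)), T c.1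

/-- In every column of the array, the characters are pairwise compatible. -/
def ColumnsCompat {R A : Type*} {T : R → Type*} {l : R → ℕ} (u : Cells T l → Option A) : Prop :=
  ∀ c t t', Compat (u ⟨c, t⟩) (u ⟨c, t'⟩)

theorem card_cells {R : Type*} [Fintype R] (T : R → Type*) [∀ v, Fintype (T v)] (l : R → ℕ) :
    Fintype.card (Cells T l) = ∑ v, Fintype.card (T v) * l v := by
  rw [Fintype.card_sigma, Fintype.sum_sigma]
  refine Finset.sum_congr rfl fun v _ => ?_
  change ∑ _ : Fin (l v), Fintype.card (T v) = _
  simp [mul_comm]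

open Classical in
/-- The probability that the columns of an array of cells are compatible, if the cells are filled by
the characters at distinct positions of a random word of length `n` with `K` holes. -/
noncomputable def columnsProb {R : Type*} [Fintype R] (A : Type*) [Fintype A] (T : R → Type*)
    [∀ v, Fintype (T v)] (n K : ℕ) (l : R → ℕ) : ℝ :=
  ∑ u : Cells T l → Option A with ColumnsCompat u,
    patternProb (Fintype.card A) n K (numHoles u) (Fintype.card (Cells T l) - numHoles u)

open Classical in
theorem card_columnsCompat {R : Type*} [Fintype R] {A : Type*} [Fintype A] (T : R → Type*)
    [∀ v, Fintype (T v)] (n K : ℕ) (l : R → ℕ) (hA : 0 < Fintype.card A) (hK : K ≤ n)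
    (f : Cells T l → Fin n) (hf : f.Injective) :
    ((Finset.univ.filter fun w : Fin n → Option A =>
        numHoles w = K ∧ ColumnsCompat (w ∘ f)).card : ℝ) =
      (Finset.univ.filter fun w : Fin n → Option A => numHoles w = K).card *
        columnsProb A T n K l := by
  have := card_comp_mem (T := Fin n) hA K (by simpa using hK) f hf ColumnsCompat
  rw [Fintype.card_fin] at this
  unfold columnsProb
  convert this

theorem columnsProb_nonneg {R : Type*} [Fintype R] (A : Type*) [Fintype A] (T : R → Type*)
    [∀ v, Fintype (T v)] (n K : ℕ) (l : R → ℕ) : 0 ≤ columnsProb A T n K l :=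
  Finset.sum_nonneg fun _ _ => patternProb_nonneg _ _ _ _ _

/-- Compatibility of all columns implies that of a subfamily. Both events are realized in one random
word by embedding the larger array into its positions. -/
theorem columnsProb_le {R : Type*} [Fintype R] {A : Type*} [Fintype A] (T : R → Type*)
    [∀ v, Fintype (T v)] (n K : ℕ) (l l' : R → ℕ) (hA : 0 < Fintype.card A) (hK : K ≤ n)
    (hl : ∀ v, l' v ≤ l v) (hn : Fintype.card (Cells T l) ≤ n) :
    columnsProb A T n K l ≤ columnsProb A T n K l' := by
  classical
  obtain ⟨f⟩ : Nonempty (Cells T l ↪ Fin n) :=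
    Function.Embedding.nonempty_of_card_le (by simpa using hn)
  let ι : Cells T l' → Cells T l := fun x => ⟨⟨x.1.1, Fin.castLE (hl _) x.1.2⟩, x.2⟩
  have hι : ι.Injective := by
    rintro ⟨⟨v, c⟩, t⟩ ⟨⟨v', c'⟩, t'⟩ h
    simp only [ι, Sigma.mk.injEq] at h
    obtain ⟨⟨rfl, h1⟩, h2⟩ := h
    have h1 := eq_of_heq h1
    have : c = c' := by simpa [Fin.ext_iff] using h1
    subst this
    have h2 := eq_of_heq h2
    subst h2
    rfl
  have h1 := card_columnsCompat T n K l hA hK f f.injective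
  have h2 := card_columnsCompat T n K l' hA hK (f ∘ ι) (f.injective.comp hι)
  have hpos : 0 < ((Finset.univ.filter fun w : Fin n → Option A => numHoles w = K).card : ℝ) := by
    rw [card_numHoles_eq]
    have := Nat.choose_pos (n := Fintype.card (Fin n)) (k := K) (by simpa using hK)
    positivity
  refine le_of_mul_le_mul_left ?_ hpos
  rw [← h1, ← h2]
  refine Nat.cast_le.2 (Finset.card_le_card fun w hw => ?_)
  simp only [Finset.mem_filter, Finset.mem_univ, true_and] at hw ⊢
  exact ⟨hw.1, fun c t t' => hw.2 ⟨c.1, Fin.castLE (hl _) c.2⟩ t t'⟩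

/-! ### Independent characters: the weight of one column -/

/-- The weight of a character: `x` for the hole, `y` for each letter. -/
def charWeight {A : Type*} (x y : ℝ) : Option A → ℝ
  | none => x
  | some _ => y

theorem prod_charWeight {S A : Type*} [Fintype S] (x y : ℝ) (u : S → Option A) :
    ∏ i, charWeight x y (u i) = x ^ numHoles u * y ^ (Fintype.card S - numHoles u) := by
  classical
  have : ∀ i, charWeight x y (u i) = if (u i).isNone then x else y := by
    intro i; cases u i <;> simp [charWeight]
  simp only [this]
  rw [Finset.prod_ite, Finset.prod_const, Finset.prod_const, numHoles]
  congr 2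
  rw [Finset.filter_not, Finset.card_sdiff_of_subset (Finset.filter_subset _ _), Finset.card_univ]

open Classical in
/-- The total weight of the compatible columns indexed by `T`. -/
noncomputable def columnWeight (A : Type*) [Fintype A] (T : Type*) [Fintype T] (x y : ℝ) : ℝ :=
  ∑ u : T → Option A with ∀ t t', Compat (u t) (u t'), ∏ t, charWeight x y (u t)

open Classical in
theorem sum_columnsCompat {R : Type*} [Fintype R] (A : Type*) [Fintype A] (T : R → Type*)
    [∀ v, Fintype (T v)] (l : R → ℕ) (x y : ℝ) :
    ∑ u : Cells T l → Option A with ColumnsCompat u,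
      x ^ numHoles u * y ^ (Fintype.card (Cells T l) - numHoles u) =
      ∏ v, columnWeight A (T v) x y ^ l v := by
  simp only [← prod_charWeight]
  have h1 : ∏ v, columnWeight A (T v) x y ^ l v =
      ∏ c : (Σ v, Fin (l v)), columnWeight A (T c.1) x y := by
    rw [Fintype.prod_sigma]
    refine Finset.prod_congr rfl fun v _ => ?_
    change _ = ∏ _ : Fin (l v), columnWeight A (T v) x y
    simp
  rw [h1]
  unfold columnWeight
  rw [Finset.prod_univ_sum]
  -- Currying turns an array into an independent choice of columns, so the sum factors.
  refine Finset.sum_equiv (Equiv.piCurry fun (c : Σ v, Fin (l v)) (_ : T c.1) => Option A) ?_ ?_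
  · intro u
    simp only [Finset.mem_filter, Finset.mem_univ, true_and, Fintype.mem_piFinset]
    rfl
  · intro u _
    rw [Fintype.prod_sigma]
    rfl

/-- A compatible column uses at most one letter. Summing over that letter counts the all-hole column
once per letter, so it must be subtracted `card A - 1` times. -/
theorem columnWeight_eq (A : Type*) [Fintype A] (T : Type*) [Fintype T] (x y : ℝ) :
    columnWeight A T x y = Fintype.card A * (x + y) ^ Fintype.card T -
      (Fintype.card A - 1) * x ^ Fintype.card T := by
  classical
  have key : ∀ u : T → Option A,
      (if ∀ t t', Compat (u t) (u t') then (1 : ℝ) else 0) =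
      (∑ a : A, if ∀ t, u t ∈ ({none, some a} : Finset (Option A)) then (1 : ℝ) else 0) -
        (Fintype.card A - 1) * if u = fun _ => none then 1 else 0 := by
    intro u
    by_cases hn : u = fun _ => none
    · subst hn
      simp [Compat]
    · obtain ⟨t₀, ht₀⟩ : ∃ t, u t ≠ none := by
        by_contra! h; exact hn (funext h)
      obtain ⟨b, hb⟩ := Option.ne_none_iff_exists'.1 ht₀
      have h1 : ∀ a, (∀ t, u t ∈ ({none, some a} : Finset (Option A))) ↔
          a = b ∧ ∀ t t', Compat (u t) (u t') := by
        intro a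
        simp only [Finset.mem_insert, Finset.mem_singleton]
        constructor
        · intro h
          refine ⟨?_, fun t t' => ?_⟩
          · rcases h t₀ with h | h
            · exact absurd h ht₀
            · rw [hb] at h; exact (Option.some_injective _ h).symm
          · rcases h t with h1 | h1
            · exact Or.inl h1
            · rcases h t' with h2 | h2
              · exact Or.inr (Or.inl h2)
              · exact Or.inr (Or.inr (h1.trans h2.symm))
        · rintro ⟨rfl, h⟩ t
          rcases h t t₀ with h | h | h
          · exact Or.inl h
          · exact absurd h ht₀
          · exact Or.inr (h.trans hb)
      simp only [h1, hn, if_false, mul_zero, sub_zero]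
      by_cases hc : ∀ t t', Compat (u t) (u t')
      · simp [hc]
      · simp [hc]
  have h2 : ∀ a : A, ∑ u : T → Option A, (if ∀ t, u t ∈ ({none, some a} : Finset (Option A))
      then (1 : ℝ) else 0) * ∏ t, charWeight x y (u t) = (x + y) ^ Fintype.card T := by
    intro a
    simp only [ite_mul, one_mul, zero_mul]
    rw [← Finset.sum_filter]
    have : (Finset.univ.filter fun u : T → Option A =>
        ∀ t, u t ∈ ({none, some a} : Finset (Option A))) =
        Fintype.piFinset fun _ => {none, some a} := by
      ext u; simp [Fintype.mem_piFinset]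
    rw [this, ← Finset.prod_univ_sum]
    simp [charWeight]
  unfold columnWeight
  rw [Finset.sum_filter]
  calc _ = ∑ u : T → Option A, (if ∀ t t', Compat (u t) (u t') then (1 : ℝ) else 0) *
        ∏ t, charWeight x y (u t) := by simp only [ite_mul, one_mul, zero_mul]
    _ = _ := by
      simp only [key, sub_mul _ _ (∏ t, charWeight x y _), Finset.sum_sub_distrib, Finset.sum_mul]
      rw [Finset.sum_comm]
      simp only [h2]
      simp only [mul_assoc, ite_mul, one_mul, zero_mul, mul_ite, mul_zero]
      rw [Finset.sum_ite_eq' Finset.univ]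
      simp [charWeight]

theorem columnWeight_eq_Q (A : Type*) [Fintype A] (T : Type*) [Fintype T] (d : ℝ)
    (hA : 0 < Fintype.card A) (hT : 0 < Fintype.card T) :
    columnWeight A T d ((1 - d) / Fintype.card A) =
      Q (Fintype.card A) d (Fintype.card T) / (Fintype.card A : ℝ) ^ (Fintype.card T - 1) := by
  rw [columnWeight_eq A T, Q]
  obtain ⟨k, hk⟩ : ∃ k, Fintype.card T = k + 1 := ⟨_, (Nat.sub_add_cancel hT).symm⟩
  have hm : (0 : ℝ) < Fintype.card A := by exact_mod_cast hA
  rw [hk, Nat.add_sub_cancel, eq_div_iff (by positivity)]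
  have : 1 + d * ((Fintype.card A : ℝ) - 1) =
      Fintype.card A * (d + (1 - d) / Fintype.card A) := by field_simp; ring
  rw [this, mul_pow, mul_pow, pow_succ (Fintype.card A : ℝ)]
  field_simp

theorem Q_pos {m k : ℕ} {d : ℝ} (hd0 : 0 < d) (hd1 : d < 1) (hm : 1 ≤ m) : 0 < Q m d k := by
  unfold Q
  have hm' : (1 : ℝ) ≤ m := by exact_mod_cast hm
  have h1 : (m * d) ^ k ≤ (1 + d * ((m : ℝ) - 1)) ^ k := by
    gcongr; nlinarith
  have h2 : 0 < (m * d) ^ k := by positivity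
  have h3 : 0 < 1 / (m : ℝ) := by positivity
  nlinarith

/-- `Q / m ^ (k - 1)` equals 1 at `k = 1` and strictly decreases from there, by the recursion in
`step`. -/
theorem Q_lt {m k : ℕ} {d : ℝ} (hd0 : 0 < d) (hd1 : d < 1) (hm : 2 ≤ m) (hk : 2 ≤ k) :
    Q m d k < (m : ℝ) ^ (k - 1) := by
  have hm' : (2 : ℝ) ≤ m := by exact_mod_cast hm
  have step : ∀ j, Q m d (j + 1) = m * Q m d j -
      (m - 1) * (1 - d) * ((1 + d * ((m : ℝ) - 1)) ^ j - (m * d) ^ j) := by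
    intro j
    unfold Q
    field_simp
    ring
  have hlt : (m : ℝ) * d < 1 + d * ((m : ℝ) - 1) := by nlinarith
  induction k, hk using Nat.le_induction with
  | base =>
    rw [step]
    have : Q m d 1 = 1 := by unfold Q; field_simp; ring
    rw [this]
    have : 0 < ((m : ℝ) - 1) * (1 - d) * ((1 + d * ((m : ℝ) - 1)) ^ 1 - (m * d) ^ 1) :=
      mul_pos (mul_pos (by linarith) (by linarith)) (by linarith)
    simp only [Nat.add_one_sub_one, pow_one, mul_one] at this ⊢
    linarith
  | succ k hk ih =>
    rw [step]
    have h1 : 0 < ((m : ℝ) - 1) * (1 - d) * ((1 + d * ((m : ℝ) - 1)) ^ k - (m * d) ^ k) :=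
      mul_pos (mul_pos (by linarith) (by linarith))
        (sub_pos.2 (pow_lt_pow_left₀ hlt (by positivity) (by omega)))
    have h2 : (m : ℝ) ^ (k + 1 - 1) = m * m ^ (k - 1) := by
      rw [← pow_succ']; congr 1; omega
    rw [h2]
    nlinarith

/-! ### Product series, uniform bounds and limits -/

theorem hasSum_fin_prod (n : ℕ) (f : Fin n → ℕ → ℝ) (a : Fin n → ℝ)
    (h0 : ∀ i j, 0 ≤ f i j) (h : ∀ i, HasSum (f i) (a i)) :
    HasSum (fun l : Fin n → ℕ => ∏ i, f i (l i)) (∏ i, a i) := by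
  induction n with
  | zero => simp
  | succ n ih =>
    have h1 := ih (fun i => f i.succ) (fun i => a i.succ) (fun i => h0 _) (fun i => h _)
    have h3 : ∀ l : Fin n → ℕ, 0 ≤ ∏ i, f i.succ (l i) :=
      fun l => Finset.prod_nonneg fun i _ => h0 _ _
    have h2 : HasSum (fun x : ℕ × (Fin n → ℕ) => f 0 x.1 * ∏ i, f i.succ (x.2 i))
        (a 0 * ∏ i : Fin n, a i.succ) := by
      generalize hg : (fun l : Fin n → ℕ => ∏ i, f i.succ (l i)) = g at h1
      have hg' : ∀ l : Fin n → ℕ, ∏ i, f i.succ (l i) = g l := congrFun hg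
      simp only [hg'] at h3 ⊢
      exact (h 0).mul h1 (Summable.mul_of_nonneg (h 0).summable h1.summable (h0 0) h3)
    rw [← (Fin.consEquiv fun _ : Fin (n + 1) => ℕ).hasSum_iff, Fin.prod_univ_succ]
    convert h2 using 2 with l
    simp [Fin.prod_univ_succ, Fin.consEquiv]

theorem hasSum_pi_prod {ι : Type*} [Fintype ι] (f : ι → ℕ → ℝ) (a : ι → ℝ)
    (h0 : ∀ i j, 0 ≤ f i j) (h : ∀ i, HasSum (f i) (a i)) :
    HasSum (fun l : ι → ℕ => ∏ i, f i (l i)) (∏ i, a i) := by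
  let e := (Fintype.equivFin ι).symm
  have := hasSum_fin_prod _ (fun i => f (e i)) (fun i => a (e i)) (fun i => h0 _) (fun i => h _)
  rw [e.prod_comp a] at this
  rw [← (e.arrowCongr (Equiv.refl ℕ)).hasSum_iff]
  convert this using 2 with l
  rw [Function.comp_apply, ← e.prod_comp]
  simp

/-- With `x = r ^ (1 / N)`, the terms are at most `x ^ j / x ^ N`. -/
theorem summable_pow_div {r : ℝ} (h0 : 0 < r) (h1 : r < 1) {N : ℕ} (hN : 0 < N) :
    Summable fun j : ℕ => r ^ (j / N) := by
  set x := r ^ ((1 : ℝ) / N) with hx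
  have hN' : (0 : ℝ) < N := by exact_mod_cast hN
  have hx0 : 0 < x := Real.rpow_pos_of_pos h0 _
  have hx1 : x < 1 := Real.rpow_lt_one h0.le h1 (by positivity)
  have hxN : x ^ N = r := by
    rw [hx, ← Real.rpow_natCast, ← Real.rpow_mul h0.le, one_div, inv_mul_cancel₀ hN'.ne',
      Real.rpow_one]
  refine Summable.of_nonneg_of_le (fun j => by positivity) (fun j => ?_)
    ((summable_geometric_of_lt_one hx0.le hx1).mul_left (x ^ N)⁻¹)
  rw [← hxN, ← pow_mul, inv_mul_eq_div, le_div_iff₀ (by positivity), ← pow_add]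
  refine pow_le_pow_of_le_one hx0.le hx1.le ?_
  have := Nat.div_add_mod j N
  have := Nat.mod_lt j hN
  omega

/-- Falling factorials in the numerator are bounded by powers. In the denominator each factor is at
least `n - n / N`, because at most `n / N` cells are prescribed. -/
theorem patternProb_le {m n K h g N : ℕ} {d : ℝ} (hm : 0 < m) (hn : 0 < n) (hN : 2 ≤ N)
    (hK : (K : ℝ) = d * n) (hd0 : 0 < d) (hd1 : d < 1) (hL : (h + g) * N ≤ n) :
    patternProb m n K h g ≤ d ^ h * ((1 - d) / m) ^ g * ((N : ℝ) / (N - 1)) ^ (h + g) := by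
  have hn' : (0 : ℝ) < n := by exact_mod_cast hn
  have hm' : (0 : ℝ) < m := by exact_mod_cast hm
  have hN' : (2 : ℝ) ≤ N := by exact_mod_cast hN
  have hKn : K ≤ n := by
    have : (K : ℝ) ≤ n := by rw [hK]; nlinarith
    exact_mod_cast this
  have hLn : h + g ≤ n := le_trans (Nat.le_mul_of_pos_right _ (by omega)) hL
  have hL' : ((h + g : ℕ) : ℝ) * N ≤ n := by exact_mod_cast hL
  have e1 : (K.descFactorial h : ℝ) ≤ (d * n) ^ h := by
    rw [← hK]; exact_mod_cast Nat.descFactorial_le_pow K h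
  have e2 : ((n - K).descFactorial g : ℝ) ≤ ((1 - d) * n) ^ g := by
    have : ((n - K : ℕ) : ℝ) = (1 - d) * n := by rw [Nat.cast_sub hKn, hK]; ring
    rw [← this]; exact_mod_cast Nat.descFactorial_le_pow (n - K) g
  have hB : (0 : ℝ) < N / (N - 1) := div_pos (by linarith) (by linarith)
  have e3 : (n / ((N : ℝ) / (N - 1))) ^ (h + g) ≤ n.descFactorial (h + g) := by
    calc (n / ((N : ℝ) / (N - 1))) ^ (h + g) ≤ ((n + 1 - (h + g) : ℕ) : ℝ) ^ (h + g) := by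
          refine pow_le_pow_left₀ (by positivity) ?_ _
          rw [Nat.cast_sub (by omega), Nat.cast_add, Nat.cast_one, div_div_eq_mul_div,
            div_le_iff₀ (by linarith)]
          nlinarith
      _ ≤ _ := by exact_mod_cast Nat.pow_sub_le_descFactorial n (h + g)
  unfold patternProb
  calc _ ≤ (d * n) ^ h * ((1 - d) * n) ^ g /
        ((n / ((N : ℝ) / (N - 1))) ^ (h + g) * (m : ℝ) ^ g) := by gcongr
    _ = _ := by
      rw [div_pow (n : ℝ), div_pow (1 - d), mul_pow, mul_pow, pow_add (n : ℝ)]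
      field_simp

-- Thinning each family to `l v / N` columns makes the array small enough for `patternProb_le`; the
-- weights then factor over columns.
open Classical in
theorem columnsProb_le_prod {R : Type*} [Fintype R] {A : Type*} [Fintype A] (T : R → Type*)
    [∀ v, Fintype (T v)] {n K N : ℕ} {d : ℝ} (l : R → ℕ) (hA : 0 < Fintype.card A) (hn : 0 < n)
    (hN : 2 ≤ N) (hK : (K : ℝ) = d * n) (hd0 : 0 < d) (hd1 : d < 1)
    (hl : Fintype.card (Cells T l) ≤ n) :
    columnsProb A T n K l ≤ ∏ v, (columnWeight A (T v) d ((1 - d) / Fintype.card A) *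
      ((N : ℝ) / (N - 1)) ^ Fintype.card (T v)) ^ (l v / N) := by
  have hn' : (0 : ℝ) < n := by exact_mod_cast hn
  have hKn : K ≤ n := by
    have : (K : ℝ) ≤ n := by rw [hK]; nlinarith
    exact_mod_cast this
  refine (columnsProb_le T n K l (fun v => l v / N) hA hKn (fun v => Nat.div_le_self _ _)
    hl).trans ?_
  have hcard : Fintype.card (Cells T fun v => l v / N) * N ≤ n := by
    refine le_trans ?_ hl
    rw [card_cells, card_cells, Finset.sum_mul]
    refine Finset.sum_le_sum fun v _ => ?_
    rw [mul_assoc]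
    exact Nat.mul_le_mul_left _ (Nat.div_mul_le_self _ _)
  calc columnsProb A T n K (fun v => l v / N)
      ≤ (∑ u : Cells T (fun v => l v / N) → Option A with ColumnsCompat u, d ^ numHoles u *
          ((1 - d) / Fintype.card A) ^ (Fintype.card (Cells T fun v => l v / N) - numHoles u)) *
          ((N : ℝ) / (N - 1)) ^ Fintype.card (Cells T fun v => l v / N) := by
        unfold columnsProb
        rw [Finset.sum_mul]
        refine Finset.sum_le_sum fun u _ => ?_
        have hu := numHoles_le u
        have := patternProb_le (h := numHoles u)
          (g := Fintype.card (Cells T fun v => l v / N) - numHoles u) hA hn hN hK hd0 hd1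
          (by rwa [Nat.add_sub_cancel' hu])
        rwa [Nat.add_sub_cancel' hu] at this
    _ = _ := by
        rw [sum_columnsCompat, card_cells, ← Finset.prod_pow_eq_pow_sum, ← Finset.prod_mul_distrib]
        refine Finset.prod_congr rfl fun v _ => ?_
        rw [mul_pow, pow_mul]

theorem tendsto_descFactorial_div {F : Filter ℕ} {x : ℕ → ℕ} (hx : Tendsto x F atTop) (h : ℕ) :
    Tendsto (fun n => ((x n).descFactorial h : ℝ) / (x n : ℝ) ^ h) F (nhds 1) := by
  have h1 := isEquivalent_descFactorial h
  rw [isEquivalent_iff_tendsto_one] at h1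
  · exact h1.comp hx
  · filter_upwards [eventually_gt_atTop 0] with n hn
    positivity

theorem tendsto_patternProb {F : Filter ℕ} {m : ℕ} {K : ℕ → ℕ} {d : ℝ} (hF : F ≤ atTop)
    (hm : 0 < m) (hK : ∀ᶠ n in F, (K n : ℝ) = d * n) (hd0 : 0 < d) (hd1 : d < 1) (h g : ℕ) :
    Tendsto (fun n => patternProb m n (K n) h g) F (nhds (d ^ h * ((1 - d) / m) ^ g)) := by
  have hm' : (m : ℝ) ≠ 0 := by positivity
  have hid : Tendsto (fun n : ℕ => n) F atTop := hF
  have hcast : Tendsto (fun n : ℕ => (n : ℝ)) F atTop := tendsto_natCast_atTop_atTop.comp hid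
  have hK1 : Tendsto K F atTop := by
    rw [← tendsto_natCast_atTop_iff (R := ℝ)]
    exact (hcast.const_mul_atTop hd0).congr' (hK.mono fun n hn => hn.symm)
  have hK2' : ∀ᶠ n in F, ((n - K n : ℕ) : ℝ) = (1 - d) * n := by
    filter_upwards [hK] with n hn
    have : K n ≤ n := by
      have : (K n : ℝ) ≤ n := by rw [hn]; nlinarith [Nat.cast_nonneg (α := ℝ) n]
      exact_mod_cast this
    rw [Nat.cast_sub this, hn]; ring
  have hK2 : Tendsto (fun n => n - K n) F atTop := by
    rw [← tendsto_natCast_atTop_iff (R := ℝ)]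
    exact (hcast.const_mul_atTop (by linarith : 0 < 1 - d)).congr' (hK2'.mono fun n hn => hn.symm)
  have e := (((tendsto_descFactorial_div hK1 h).mul (tendsto_descFactorial_div hK2 g)).div
    (tendsto_descFactorial_div hid (h + g)) one_ne_zero).mul_const (d ^ h * ((1 - d) / m) ^ g)
  rw [mul_one, div_one, one_mul] at e
  refine e.congr' ?_
  filter_upwards [hK, hK2', hid.eventually_gt_atTop 0] with n h1 h2 h3
  have h3' : (0 : ℝ) < n := by exact_mod_cast h3
  have h4 : (0 : ℝ) < 1 - d := by linarith
  simp only [Pi.div_apply]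
  rw [h1, h2, patternProb, div_pow, mul_pow, mul_pow, pow_add]
  field_simp

theorem tendsto_columnsProb {R : Type*} [Fintype R] {A : Type*} [Fintype A] (T : R → Type*)
    [∀ v, Fintype (T v)] {F : Filter ℕ} {K : ℕ → ℕ} {d : ℝ} (hF : F ≤ atTop)
    (hA : 0 < Fintype.card A) (hK : ∀ᶠ n in F, (K n : ℝ) = d * n) (hd0 : 0 < d) (hd1 : d < 1)
    (l : R → ℕ) :
    Tendsto (fun n => columnsProb A T n (K n) l) F
      (nhds (∏ v, columnWeight A (T v) d ((1 - d) / Fintype.card A) ^ l v)) := by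
  rw [← sum_columnsCompat]
  exact tendsto_finsetSum _ fun u _ => tendsto_patternProb hF hA hK hd0 hd1 _ _

theorem tendsto_choose_div_pow {F : Filter ℕ} (hF : F ≤ atTop) (x s : ℕ) :
    Tendsto (fun n : ℕ => ((n + 1 - x).choose s : ℝ) / (n : ℝ) ^ s) F (nhds (1 / (s ! : ℝ))) := by
  have hid : Tendsto (fun n : ℕ => n) F atTop := hF
  have h1 := isEquivalent_choose s
  rw [isEquivalent_iff_tendsto_one] at h1
  swap
  · filter_upwards [eventually_gt_atTop 0] with n hn
    positivity
  have h2 : Tendsto (fun n : ℕ => n + 1 - x) F atTop :=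
    (tendsto_sub_atTop_nat x).comp ((tendsto_add_atTop_nat 1).comp hid)
  have h3 : Tendsto (fun n : ℕ => 1 + (1 - (x : ℝ)) / n) F (nhds (1 + 0)) :=
    tendsto_const_nhds.add ((tendsto_const_div_atTop_nhds_zero_nat _).comp hid)
  have e := ((h1.comp h2).mul (h3.pow s)).mul_const (1 / (s ! : ℝ))
  rw [add_zero, one_pow, mul_one, one_mul] at e
  refine e.congr' ?_
  filter_upwards [hid.eventually_gt_atTop 0, hid.eventually_ge_atTop x] with n h3 h4
  have h3' : (0 : ℝ) < n := by exact_mod_cast h3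
  have h5 : 1 + (1 - (x : ℝ)) / n = (n + 1 - x : ℕ) / n := by
    rw [Nat.cast_sub (by omega)]; field_simp; push_cast; ring
  have h6 : (0 : ℝ) < (n + 1 - x : ℕ) := by exact_mod_cast (by omega : 0 < n + 1 - x)
  simp only [Function.comp_apply, Pi.div_apply]
  rw [h5, div_pow]
  field_simp

theorem choose_div_pow_le {n : ℕ} (hn : 0 < n) (x s : ℕ) :
    ((n + 1 - x).choose s : ℝ) / (n : ℝ) ^ s ≤ 2 ^ s := by
  have hn' : (0 : ℝ) < n := by exact_mod_cast hn
  rw [div_le_iff₀ (by positivity), ← mul_pow]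
  calc ((n + 1 - x).choose s : ℝ) ≤ ((n + 1 - x : ℕ) : ℝ) ^ s := by
        exact_mod_cast Nat.choose_le_pow _ _
    _ ≤ _ := by
        refine pow_le_pow_left₀ (by positivity) ?_ s
        exact_mod_cast (by omega : n + 1 - x ≤ 2 * n)

theorem exists_mul_pow_lt_one {R : Type*} [Fintype R] (q : R → ℝ) (k : R → ℕ)
    (hq : ∀ v, q v < 1) : ∃ N : ℕ, 2 ≤ N ∧ ∀ v, q v * ((N : ℝ) / (N - 1)) ^ k v < 1 := by
  have h1 : Tendsto (fun N : ℕ => (N : ℝ) / (N - 1)) atTop (nhds 1) := by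
    simpa [sub_eq_add_neg] using tendsto_natCast_div_add_atTop (𝕜 := ℝ) (-1)
  have h2 : ∀ v, ∀ᶠ N : ℕ in atTop, q v * ((N : ℝ) / (N - 1)) ^ k v < 1 := by
    intro v
    have := (h1.pow (k v)).const_mul (q v)
    rw [one_pow, mul_one] at this
    exact this.eventually_lt_const (hq v)
  obtain ⟨N, h3, h4⟩ := ((eventually_ge_atTop 2).and (eventually_all.2 h2)).exists
  exact ⟨N, h3, h4⟩

/-- Dominated convergence for series. The shift `l v + 1` encodes that images are nonempty. -/
theorem tendsto_tsum_columnsProb {R : Type*} [Fintype R] {A : Type*} [Fintype A] (T : R → Type*)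
    [∀ v, Fintype (T v)] {F : Filter ℕ} {K : ℕ → ℕ} {d : ℝ} (hF : F ≤ atTop)
    (hA : 0 < Fintype.card A) (hK : ∀ᶠ n in F, (K n : ℝ) = d * n) (hd0 : 0 < d) (hd1 : d < 1)
    (hq0 : ∀ v, 0 < columnWeight A (T v) d ((1 - d) / Fintype.card A))
    (hq1 : ∀ v, columnWeight A (T v) d ((1 - d) / Fintype.card A) < 1) (s : ℕ) :
    Tendsto (fun n => ∑' l : R → ℕ, columnsProb A T n (K n) (fun v => l v + 1) *
        (((n + 1 - Fintype.card (Cells T fun v => l v + 1)).choose (s + 1) : ℝ) / (n : ℝ) ^ (s + 1)))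
      F (nhds ((∏ v, columnWeight A (T v) d ((1 - d) / Fintype.card A) /
        (1 - columnWeight A (T v) d ((1 - d) / Fintype.card A))) * (1 / ((s + 1)! : ℝ)))) := by
  set q : R → ℝ := fun v => columnWeight A (T v) d ((1 - d) / Fintype.card A) with hq
  obtain ⟨N, hN, hNq⟩ := exists_mul_pow_lt_one q (fun v => Fintype.card (T v)) hq1
  set ρ : R → ℝ := fun v => q v * ((N : ℝ) / (N - 1)) ^ Fintype.card (T v) with hρ
  have hN' : (2 : ℝ) ≤ N := by exact_mod_cast hN
  have hρ0 : ∀ v, 0 < ρ v := fun v =>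
    mul_pos (hq0 v) (pow_pos (div_pos (by linarith) (by linarith)) _)
  have hlim : HasSum (fun l : R → ℕ => (∏ v, q v ^ (l v + 1)) * (1 / ((s + 1)! : ℝ)))
      ((∏ v, q v / (1 - q v)) * (1 / ((s + 1)! : ℝ))) := by
    refine (hasSum_pi_prod (fun v j => q v ^ (j + 1)) _ (fun v j => (pow_pos (hq0 v) _).le)
      fun v => ?_).mul_right _
    simp only [pow_succ', div_eq_mul_inv]
    exact (hasSum_geometric_of_lt_one (hq0 v).le (hq1 v)).mul_left (q v)
  change Tendsto _ F (nhds ((∏ v, q v / (1 - q v)) * (1 / ((s + 1)! : ℝ))))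
  rw [← hlim.tsum_eq]
  have hsum : Summable fun l : R → ℕ => (∏ v, ρ v ^ ((l v + 1) / N)) * 2 ^ (s + 1) := by
    refine Summable.mul_right _ (hasSum_pi_prod (fun v j => ρ v ^ ((j + 1) / N)) _
      (fun v j => (pow_pos (hρ0 v) _).le) fun v => Summable.hasSum ?_).summable
    exact (summable_nat_add_iff 1).2 (summable_pow_div (hρ0 v) (hNq v) (by omega))
  refine tendsto_tsum_of_dominated_convergence hsum (fun l => ?_) ?_
  · exact (tendsto_columnsProb T hF hA hK hd0 hd1 _).mul (tendsto_choose_div_pow hF _ _)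
  · filter_upwards [hK, hF (eventually_gt_atTop 0)] with n hKn hn l
    have h0 : 0 ≤ columnsProb A T n (K n) (fun v => l v + 1) := columnsProb_nonneg _ _ _ _ _
    have hP : 0 ≤ ∏ v, ρ v ^ ((l v + 1) / N) :=
      Finset.prod_nonneg fun v _ => (pow_pos (hρ0 v) _).le
    rw [Real.norm_of_nonneg (by positivity)]
    by_cases hl : Fintype.card (Cells T fun v => l v + 1) ≤ n
    · exact mul_le_mul (columnsProb_le_prod T _ hA hn hN hKn hd0 hd1 hl)
        (choose_div_pow_le hn _ _) (by positivity) hP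
    -- An array larger than the word contributes nothing: truncated subtraction gives `Nat.choose 0
    -- (s + 1) = 0`.
    · rw [Nat.sub_eq_zero_of_le (by omega), Nat.choose_zero_succ]
      simp only [Nat.cast_zero, zero_div, mul_zero]
      positivity

/-! ### Counting positions and lengths -/

section Arrangements

variable {W : Type*} [DecidableEq W]

/-- The variables that occur at least twice in `q`. -/
abbrev Repeated (q : List W) : Type _ := {v : W // 2 ≤ q.count v}

/-- The variables that occur at most once in `q`. -/
abbrev Unrepeated (q : List W) : Type _ := {v : W // ¬ 2 ≤ q.count v}

/-- The occurrences of `v` in `q`. -/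
abbrev Instances (q : List W) (v : Repeated q) : Type := {t : Fin q.length // q.get t = v.1}

theorem card_get_eq (q : List W) (v : W) :
    Fintype.card {t : Fin q.length // q.get t = v} = q.count v := by
  rw [Fintype.card_subtype]
  exact Fin.card_filter_univ_eq_vector_get_eq_count v ⟨q, rfl⟩

/-- Distinct cells lie at distinct positions (`start_add_inj`), and variables without repetition
impose no condition. -/
theorem fits_iff_columnsCompat {A : Type*} (q : List W) {n i : ℕ} {l : W → ℕ}
    (hl : i + (q.map l).sum ≤ n) :
    ∃ f : Cells (Instances q) (fun v => l v.1) → Fin n, f.Injective ∧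
      ∀ w : Fin n → Option A, Fits q (fun j => (List.ofFn w).getD (i + j) none) l ↔
        ColumnsCompat (w ∘ f) := by
  have hlt : ∀ x : Cells (Instances q) (fun v => l v.1), (x.1.2 : ℕ) < l (q.get x.2.1) :=
    fun x => by rw [x.2.2]; exact x.1.2.2
  have hpos : ∀ x : Cells (Instances q) (fun v => l v.1),
      i + (start q l x.2.1 + x.1.2) < n := fun x => by
    have := start_add_lt q l x.2.1 x.2.1.2 (hlt x)
    omega
  refine ⟨fun x => ⟨_, hpos x⟩, ?_, fun w => ?_⟩
  · rintro ⟨⟨v, c⟩, t⟩ ⟨⟨v', c'⟩, t'⟩ h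
    simp only [Fin.mk.injEq, Nat.add_left_cancel_iff] at h
    obtain ⟨h1, h2⟩ := start_add_inj q l t.1 t'.1 t.1.2 t'.1.2 (hlt ⟨⟨v, c⟩, t⟩)
      (hlt ⟨⟨v', c'⟩, t'⟩) h
    have h3 : t.1 = t'.1 := Fin.ext h1
    have hv : v = v' := Subtype.ext (by rw [← t.2, ← t'.2, h3])
    subst hv
    have hc : c = c' := Fin.ext h2
    subst hc
    have ht : t = t' := Subtype.ext h3
    subst ht
    rfl
  · have hget : ∀ x : Cells (Instances q) (fun v => l v.1),
        (List.ofFn w).getD (i + (start q l x.2.1 + x.1.2)) none = w ⟨_, hpos x⟩ := by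
      intro x
      rw [List.getD_eq_getElem _ _ (by simpa using hpos x), List.getElem_ofFn]
    constructor
    · intro H c t t'
      have := H t.1 t'.1 (t.2.trans t'.2.symm) c.2 (hlt ⟨c, t⟩)
      have h1 := hget ⟨c, t⟩
      have h2 := hget ⟨c, t'⟩
      simp only at this h1 h2
      rwa [h1, h2] at this
    · intro H t t' htt c hc
      by_cases h : t = t'
      · subst h; exact Compat.refl _
      · have h2 : 2 ≤ q.count (q.get t) := by
          rw [← card_get_eq]
          exact Fintype.one_lt_card_iff.2 ⟨⟨t, rfl⟩, ⟨t', htt.symm⟩, by simpa using h⟩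
        have := H ⟨⟨q.get t, h2⟩, ⟨c, hc⟩⟩ ⟨t, rfl⟩ ⟨t', htt.symm⟩
        simp only [Function.comp_apply] at this
        rw [← hget ⟨⟨⟨q.get t, h2⟩, ⟨c, hc⟩⟩, ⟨t, rfl⟩⟩,
          ← hget ⟨⟨⟨q.get t, h2⟩, ⟨c, hc⟩⟩, ⟨t', htt.symm⟩⟩] at this
        exact this

variable [Fintype W]

/-- The pairs of a starting position and lengths of the images of the variables for which the image
of `q` fits into a word of length `n`. -/
def arrangements (q : List W) (n : ℕ) : Finset (ℕ × (W → ℕ)) :=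
  (Finset.range (n + 1) ×ˢ Fintype.piFinset fun _ => Finset.Icc 1 n).filter
    fun z => z.1 + (q.map z.2).sum ≤ n

theorem mem_arrangements {q : List W} (hq : ∀ v, v ∈ q) {n : ℕ} {z : ℕ × (W → ℕ)} :
    z ∈ arrangements q n ↔ (∀ v, 1 ≤ z.2 v) ∧ z.1 + (q.map z.2).sum ≤ n := by
  simp only [arrangements, Finset.mem_filter, Finset.mem_product, Finset.mem_range,
    Fintype.mem_piFinset, Finset.mem_Icc]
  constructor
  · rintro ⟨⟨-, h1⟩, h2⟩
    exact ⟨fun v => (h1 v).1, h2⟩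
  · rintro ⟨h1, h2⟩
    refine ⟨⟨by omega, fun v => ⟨h1 v, ?_⟩⟩, h2⟩
    have := List.single_le_sum (l := q.map z.2) (by simp) (z.2 v) (List.mem_map_of_mem (hq v))
    omega

theorem sum_map_eq {q : List W} (hq : ∀ v, v ∈ q) (l : W → ℕ) :
    (q.map l).sum = Fintype.card (Cells (Instances q) fun v => l v.1) +
      ∑ v : Unrepeated q, l v.1 := by
  rw [card_cells (Instances q) fun v => l v.1, Finset.sum_list_map_count]
  have : q.toFinset = Finset.univ := by ext v; simp [hq v]
  rw [this, ← Fintype.sum_subtype_add_sum_subtype (fun v => 2 ≤ q.count v)]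
  congr 1
  · exact Finset.sum_congr rfl fun v _ => by rw [card_get_eq, smul_eq_mul]
  · refine Finset.sum_congr rfl fun v _ => ?_
    have h1 := List.count_pos_iff.2 (hq v.1)
    have h2 := v.2
    rw [show q.count v.1 = 1 by omega, one_smul]

/-- Stars and bars: the slack after the occurrence, the starting position, and each unrepeated
length minus 1 are nonnegative integers with a fixed sum. -/
theorem card_arrangements_fiber {q : List W} (hq : ∀ v, v ∈ q) (n : ℕ) (l : Repeated q → ℕ) :
    ((arrangements q n).filter fun z => (fun v : Repeated q => z.2 v.1 - 1) = l).card =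
      (n + 1 - Fintype.card (Cells (Instances q) fun v => l v + 1)).choose
        (Fintype.card (Unrepeated q) + 1) := by
  set U := Unrepeated q
  set L := Fintype.card (Cells (Instances q) fun v => l v + 1) with hL
  have hmem : ∀ z, z ∈ (arrangements q n).filter
      (fun z => (fun v : Repeated q => z.2 v.1 - 1) = l) ↔
      (∀ v : Repeated q, z.2 v.1 = l v + 1) ∧ (∀ v : U, 1 ≤ z.2 v.1) ∧
        z.1 + (L + ∑ v : U, z.2 v.1) ≤ n := by
    intro z
    rw [Finset.mem_filter, mem_arrangements hq, sum_map_eq hq]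
    constructor
    · rintro ⟨⟨h1, h2⟩, rfl⟩
      have h3 : ∀ v : Repeated q, z.2 v.1 = z.2 v.1 - 1 + 1 := fun v => by
        have := h1 v.1; omega
      refine ⟨h3, fun v => h1 v.1, ?_⟩
      rw [hL]
      simpa only [← h3] using h2
    · rintro ⟨h1, h2, h3⟩
      refine ⟨⟨fun v => ?_, ?_⟩, funext fun v => by rw [h1 v]; rfl⟩
      · by_cases hv : 2 ≤ q.count v
        · rw [h1 ⟨v, hv⟩]; omega
        · exact h2 ⟨v, hv⟩
      · simpa only [h1] using h3
  have hcard : ∀ z : ℕ × (W → ℕ), (∀ v : U, 1 ≤ z.2 v.1) →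
      ∑ v : U, z.2 v.1 = ∑ v : U, (z.2 v.1 - 1) + Fintype.card U := by
    intro z hz
    rw [← Finset.card_univ, Finset.card_eq_sum_ones, ← Finset.sum_add_distrib]
    exact Finset.sum_congr rfl fun v _ => (Nat.sub_add_cancel (hz v)).symm
  by_cases hn : L + Fintype.card U ≤ n
  · obtain ⟨M, hM⟩ : ∃ M, n = L + Fintype.card U + M := ⟨n - (L + Fintype.card U), by omega⟩
    have hchoose : (n + 1 - L).choose (Fintype.card U + 1) =
        ((Finset.univ : Finset (Option (Option U))).finsuppAntidiag M).card := by
      rw [Finset.card_finsuppAntidiag_nat_eq_choose, Finset.card_univ, Fintype.card_option,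
        Fintype.card_option]
      rw [show n + 1 - L = M + (Fintype.card U + 1) by omega,
        show Fintype.card U + 1 + 1 + M - 1 = M + (Fintype.card U + 1) by omega]
      exact Nat.choose_symm_add.symm
    rw [hchoose]
    -- In `Option (Option U)`, `none` carries the slack, `some none` the starting position, and
    -- `some (some v)` the reduced length of `v`.
    refine Finset.card_bij'
      (fun z _ => Finsupp.equivFunOnFinite.symm fun o : Option (Option U) =>
        o.elim (n - (z.1 + (L + ∑ v : U, z.2 v.1))) fun o' => o'.elim z.1 fun v => z.2 v.1 - 1)
      (fun f _ => (f (some none), fun v => if h : 2 ≤ q.count v then l ⟨v, h⟩ + 1 else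
        f (some (some ⟨v, h⟩)) + 1)) ?_ ?_ ?_ ?_
    · intro z hz
      obtain ⟨h1, h2, h3⟩ := (hmem z).1 hz
      have := hcard z h2
      rw [Finset.mem_finsuppAntidiag]
      refine ⟨?_, Finset.subset_univ _⟩
      simp only [Fintype.sum_option, Finsupp.equivFunOnFinite_symm_apply_apply, Option.elim]
      omega
    · intro f hf
      rw [Finset.mem_finsuppAntidiag] at hf
      have hf1 := hf.1
      simp only [Fintype.sum_option] at hf1
      rw [hmem]
      refine ⟨fun v => by simp [v.2], fun v => by simp [v.2], ?_⟩
      have : ∀ v : U, (if h : 2 ≤ q.count v.1 then l ⟨v.1, h⟩ + 1 else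
        f (some (some ⟨v.1, h⟩)) + 1) = f (some (some v)) + 1 := fun v => by rw [dif_neg v.2]
      simp only [this, Finset.sum_add_distrib, Finset.sum_const, Finset.card_univ, smul_eq_mul]
      omega
    · intro z hz
      obtain ⟨h1, h2, h3⟩ := (hmem z).1 hz
      refine Prod.ext rfl (funext fun v => ?_)
      by_cases hv : 2 ≤ q.count v
      · simp only [hv, dite_true]
        exact (h1 ⟨v, hv⟩).symm
      · simp only [hv, dite_false, Finsupp.equivFunOnFinite_symm_apply_apply, Option.elim]
        exact Nat.sub_add_cancel (h2 ⟨v, hv⟩)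
    · intro f hf
      rw [Finset.mem_finsuppAntidiag] at hf
      have hf1 := hf.1
      simp only [Fintype.sum_option] at hf1
      have : ∀ v : U, (if h : 2 ≤ q.count v.1 then l ⟨v.1, h⟩ + 1 else
        f (some (some ⟨v.1, h⟩)) + 1) = f (some (some v)) + 1 := fun v => by rw [dif_neg v.2]
      ext o
      rw [Finsupp.equivFunOnFinite_symm_apply_apply]
      rcases o with _ | _ | v
      · simp only [this, Finset.sum_add_distrib, Finset.sum_const, Finset.card_univ, smul_eq_mul,
          Option.elim]
        omega
      · rfl
      · simp only [Option.elim, this, Nat.add_sub_cancel]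
  · rw [Nat.choose_eq_zero_of_lt (show n + 1 - L < Fintype.card U + 1 by omega), Finset.card_eq_zero,
      Finset.eq_empty_iff_forall_notMem]
    intro z hz
    obtain ⟨-, h2, h3⟩ := (hmem z).1 hz
    have := hcard z h2
    omega

theorem sum_arrangements {q : List W} (hq : ∀ v, v ∈ q) (n : ℕ) (g : (Repeated q → ℕ) → ℝ) :
    ∑ z ∈ arrangements q n, g (fun v => z.2 v.1) =
      ∑' l : Repeated q → ℕ, g (fun v => l v + 1) *
        ((n + 1 - Fintype.card (Cells (Instances q) fun v => l v + 1)).choose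
          (Fintype.card (Unrepeated q) + 1) : ℕ) := by
  rw [tsum_eq_sum (s := (arrangements q n).image fun z => fun v : Repeated q => z.2 v.1 - 1)]
  · rw [← Finset.sum_fiberwise_of_maps_to
      (fun z hz => Finset.mem_image_of_mem (fun z => fun v : Repeated q => z.2 v.1 - 1) hz)]
    refine Finset.sum_congr rfl fun l _ => ?_
    rw [← card_arrangements_fiber hq, mul_comm, ← nsmul_eq_mul]
    refine Finset.sum_eq_card_nsmul fun z hz => ?_
    rw [Finset.mem_filter, mem_arrangements hq] at hz
    obtain ⟨⟨h1, -⟩, rfl⟩ := hz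
    congr 1
    funext v
    exact (Nat.sub_add_cancel (h1 v.1)).symm
  · intro l hl
    rw [← card_arrangements_fiber hq, Finset.card_eq_zero.2, Nat.cast_zero, mul_zero]
    rw [Finset.eq_empty_iff_forall_notMem]
    intro z hz
    rw [Finset.mem_filter] at hz
    exact hl (Finset.mem_image.2 ⟨z, hz.1, hz.2⟩)

end Arrangements

/-! ### Exact formula for the mean and conclusion -/

theorem count_attach_eq {V : Type*} [DecidableEq V] (p : List V) (v : {v // v ∈ p}) :
    @List.count _ instBEqOfDecidableEq v p.attach = p.count v.1 := by
  rw [← List.count_attach]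
  congr 1
  exact lawful_beq_subsingleton _ _

/-- Linearity of expectation: swap the sums over words and arrangements, then group arrangements by
the lengths of the repeated variables. -/
theorem meanOccurrences_eq {V : Type*} [DecidableEq V] {A : Type*} [Fintype A] (p : List V)
    {n K : ℕ} {d : ℚ} (hA : 0 < Fintype.card A) (hn : 0 < n) (hK : (K : ℚ) = d * n)
    (hKn : K ≤ n) :
    meanOccurrences p A n d = ∑' l : Repeated p.attach → ℕ,
      columnsProb A (Instances p.attach) n K (fun v => l v + 1) *
        ((n + 1 - Fintype.card (Cells (Instances p.attach) fun v => l v + 1)).choose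
          (Fintype.card (Unrepeated p.attach) + 1) : ℕ) := by
  classical
  have hq : ∀ v, v ∈ p.attach := List.mem_attach p
  rw [← sum_arrangements hq n (columnsProb A (Instances p.attach) n K)]
  have hn' : (n : ℚ) ≠ 0 := by positivity
  have hdens : withDensity A n d = Finset.univ.filter fun w : Fin n → Option A =>
      numHoles w = K := by
    ext w
    simp only [withDensity, Finset.mem_filter, Finset.mem_univ, true_and]
    rw [div_eq_iff hn', ← hK, Nat.cast_inj]
    rfl
  have hpos : (0 : ℝ) < (Finset.univ.filter fun w : Fin n → Option A => numHoles w = K).card := by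
    rw [card_numHoles_eq]
    have := Nat.choose_pos (n := Fintype.card (Fin n)) (k := K) (by simpa using hKn)
    positivity
  have hocc : ∀ w : Fin n → Option A, ((occurrences p (List.ofFn w)).ncard : ℝ) =
      ∑ z ∈ arrangements p.attach n,
        if Fits p.attach (fun j => (List.ofFn w).getD (z.1 + j) none) z.2 then 1 else 0 := by
    intro w
    rw [ncard_occurrences, ← Finset.sum_filter, Finset.sum_const, nsmul_eq_mul, mul_one,
      ← Set.ncard_coe_finset]
    congr 2
    ext z
    simp only [Set.mem_ofPred_eq, Finset.coe_filter, mem_arrangements hq, List.length_ofFn,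
      and_assoc]
  rw [meanOccurrences, hdens, div_eq_iff hpos.ne']
  simp only [hocc]
  rw [Finset.sum_comm, Finset.sum_mul]
  refine Finset.sum_congr rfl fun z hz => ?_
  obtain ⟨f, hf, hfit⟩ := fits_iff_columnsCompat (A := A) p.attach ((mem_arrangements hq).1 hz).2
  rw [mul_comm, ← card_columnsCompat (Instances p.attach) n K (fun v => z.2 v.1) hA hKn f hf,
    ← Finset.sum_filter, Finset.sum_const, nsmul_eq_mul, mul_one, Finset.filter_filter]
  simp only [hfit]

theorem meanOccurrences_isEquivalent {V : Type*} [DecidableEq V] {A : Type*} [Fintype A]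
    (p : List V) (m s : ℕ) (hA : Fintype.card A = m)
    (hm : 2 ≤ m ∨ (m = 1 ∧ p.Nodup))
    (hs : s = (p.toFinset.filter fun v => p.count v = 1).card)
    (d : ℚ) (hd0 : 0 < d) (hd1 : d < 1) :
    (fun n : ℕ => PartialWord.meanOccurrences p A n d)
      ~[atTop ⊓ 𝓟 {n : ℕ | ∃ h : ℕ, (h : ℚ) = d * n}]
    (fun n : ℕ => (n : ℝ) ^ (s + 1) / ((s + 1)! : ℝ) *
      ∏ v ∈ p.toFinset.filter (fun v => 2 ≤ p.count v),
        PartialWord.Q m d (p.count v) /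
          ((m : ℝ) ^ (p.count v - 1) - PartialWord.Q m d (p.count v))) := by
  subst hA
  have hA : 0 < Fintype.card A := by omega
  have hA' : (0 : ℝ) < Fintype.card A := by exact_mod_cast hA
  have hd0' : (0 : ℝ) < d := by exact_mod_cast hd0
  have hd1' : (d : ℝ) < 1 := by exact_mod_cast hd1
  set F := atTop ⊓ 𝓟 {n : ℕ | ∃ h : ℕ, (h : ℚ) = d * n} with hF
  have hFle : F ≤ atTop := inf_le_left
  -- The floor makes `K` total; along `F` it is exactly `d * n`.
  let K : ℕ → ℕ := fun n => ⌊d * n⌋₊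
  have hK : ∀ᶠ n in F, (K n : ℚ) = d * n := by
    refine Filter.Eventually.filter_mono inf_le_right (mem_principal.2 ?_)
    rintro n ⟨h, hh⟩
    simp only [Set.mem_ofPred_eq, K]
    rw [← hh, Nat.floor_natCast]
  have hKR : ∀ᶠ n in F, (K n : ℝ) = (d : ℝ) * n := hK.mono fun n hn => by exact_mod_cast hn
  have hcount := count_attach_eq p
  have hcardT : ∀ v : Repeated p.attach, Fintype.card (Instances p.attach v) = p.count v.1.1 :=
    fun v => by rw [card_get_eq, hcount]
  have hk2 : ∀ v : Repeated p.attach, 2 ≤ p.count v.1.1 := fun v => hcount v.1 ▸ v.2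
  have hQ0 : ∀ k, 0 < Q (Fintype.card A) d k := fun k => Q_pos hd0' hd1' hA
  have hQ1 : ∀ v : Repeated p.attach, Q (Fintype.card A) d (p.count v.1.1) <
      (Fintype.card A : ℝ) ^ (p.count v.1.1 - 1) := by
    intro v
    rcases hm with hm | ⟨-, hp⟩
    · exact Q_lt hd0' hd1' hm (hk2 v)
    · have h1 := List.nodup_iff_count_le_one.1 hp v.1.1
      have h2 := hk2 v
      omega
  have hweight : ∀ v : Repeated p.attach,
      columnWeight A (Instances p.attach v) d ((1 - d) / Fintype.card A) =
        Q (Fintype.card A) d (p.count v.1.1) / (Fintype.card A : ℝ) ^ (p.count v.1.1 - 1) := by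
    intro v
    have := hk2 v
    rw [columnWeight_eq_Q A _ _ hA (by rw [hcardT]; omega), hcardT]
  have hs' : Fintype.card (Unrepeated p.attach) = s := by
    rw [hs, Fintype.card_subtype]
    refine Finset.card_bij (fun v _ => v.1) ?_ (fun _ _ _ _ h => Subtype.ext h) ?_
    · intro v hv
      have h1 := List.count_pos_iff.2 v.2
      simp only [Finset.mem_filter, Finset.mem_univ, true_and, hcount, List.mem_toFinset] at hv ⊢
      exact ⟨v.2, by omega⟩
    · intro v hv
      simp only [Finset.mem_filter, List.mem_toFinset] at hv
      refine ⟨⟨v, hv.1⟩, ?_, rfl⟩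
      simp only [Finset.mem_filter, Finset.mem_univ, true_and, hcount]
      omega
  set c : ℝ := ∏ v ∈ p.toFinset.filter (fun v => 2 ≤ p.count v),
    Q (Fintype.card A) d (p.count v) /
      ((Fintype.card A : ℝ) ^ (p.count v - 1) - Q (Fintype.card A) d (p.count v)) with hc
  have hprod : ∏ v, columnWeight A (Instances p.attach v) d ((1 - d) / Fintype.card A) /
      (1 - columnWeight A (Instances p.attach v) d ((1 - d) / Fintype.card A)) = c := by
    refine Finset.prod_bij (fun v _ => v.1.1) ?_
      (fun _ _ _ _ h => Subtype.ext (Subtype.ext h)) ?_ ?_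
    · intro v _
      simp only [Finset.mem_filter, List.mem_toFinset]
      exact ⟨v.1.2, hk2 v⟩
    · intro v hv
      simp only [Finset.mem_filter, List.mem_toFinset] at hv
      exact ⟨⟨⟨v, hv.1⟩, by rw [hcount]; exact hv.2⟩, Finset.mem_univ _, rfl⟩
    · intro v _
      have h1 : (0 : ℝ) < (Fintype.card A : ℝ) ^ (p.count v.1.1 - 1) := by positivity
      rw [hweight, one_sub_div h1.ne', div_div_div_cancel_right₀ h1.ne']
  have hc0 : 0 < c := by
    rw [← hprod]
    refine Finset.prod_pos fun v _ => ?_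
    have h1 : (0 : ℝ) < (Fintype.card A : ℝ) ^ (p.count v.1.1 - 1) := by positivity
    rw [hweight]
    exact div_pos (div_pos (hQ0 _) h1) (sub_pos.2 ((div_lt_one h1).2 (hQ1 v)))
  have hlim := tendsto_tsum_columnsProb (Instances p.attach) hFle hA hKR hd0' hd1'
    (fun v => by rw [hweight]; exact div_pos (hQ0 _) (by positivity))
    (fun v => by rw [hweight]; exact (div_lt_one (by positivity)).2 (hQ1 v)) s
  -- Convergence upgrades to equivalence because the limit is nonzero, by `hc0`.
  rw [hprod, ← isEquivalent_const_iff_tendsto (by positivity)] at hlim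
  have hmul := (IsEquivalent.refl (u := fun n : ℕ => (n : ℝ) ^ (s + 1)) (l := F)).mul hlim
  refine (hmul.congr_left ?_).congr_right (Eventually.of_forall fun n => ?_)
  · filter_upwards [hK, hFle (eventually_gt_atTop 0)] with n hn hn0
    have hKn : K n ≤ n := by
      have h1 : (K n : ℚ) ≤ n := by
        rw [hn]; exact mul_le_of_le_one_left (Nat.cast_nonneg n) hd1.le
      exact_mod_cast h1
    have hn0' : (0 : ℝ) < n := by exact_mod_cast hn0
    rw [meanOccurrences_eq p hA hn0 hn hKn, hs', Pi.mul_apply, ← tsum_mul_left]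
    refine tsum_congr fun l => ?_
    field_simp
  · simp only [Pi.mul_apply, Function.const_apply]
    ring

end PartialWord

theorem mainTheorem8 {V : Type*} [DecidableEq V] {A : Type*} [Fintype A]
    (p : List V) (m s : ℕ) (hA : Fintype.card A = m)
    (hm : 2 ≤ m ∨ (m = 1 ∧ p.Nodup))
    (hs : s = (p.toFinset.filter fun v => p.count v = 1).card)
    (d : ℚ) (hd0 : 0 < d) (hd1 : d < 1) :
    (fun n : ℕ => PartialWord.meanOccurrences p A n d)
      ~[atTop ⊓ 𝓟 {n : ℕ | ∃ h : ℕ, (h : ℚ) = d * n}]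
    (fun n : ℕ => (n : ℝ) ^ (s + 1) / ((s + 1)! : ℝ) *
      ∏ v ∈ p.toFinset.filter (fun v => 2 ≤ p.count v),
        PartialWord.Q m d (p.count v) /
          ((m : ℝ) ^ (p.count v - 1) - PartialWord.Q m d (p.count v))) :=
  PartialWord.meanOccurrences_isEquivalent p m s hA hm hs d hd0 hd1
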